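/- Let $k$ be an algebraically closed field of characteristic zero. For $n\ge 1$ let $\mathcal A_s(n)$ be the Hopf algebra over $k$ presented as an algebra by generators $u_{ij}$, $1\le i,j\le n$, and relations $u_{ij}u_{il}=\delta_{jl}u_{ij}$, $u_{ij}u_{lj}=\delta_{il}u_{ij}$, $\sum_{l=1}^n u_{il}=1=\sum_{l=1}^n u_{li}$, with $\Delta(u_{ij})=\sum_{l=1}^n u_{il}\otimes u_{lj}$, $\varepsilon(u_{ij})=\delta_{ij}$, $S(u_{ij})=u_{ji}$. A Hopf algebra $H$ over $k$ is called a quantum permutation algebra if, for some $n\ge 1$, it is a quotient Hopf algebra of $\mathcal A_s(n)$, that is, there is a surjective Hopf algebra map $\mathcal A_s(n)\to H$; the smallest such $n\ge 1$ is its degree $d(H)$. Let $G$ be a finite group, and let $D(G)=(k^G)^{\mathrm{cop}}\bowtie kG$ be the Drinfeld double of the group algebra $kG$: the Hopf algebra with basis $e_g\bowtie h$ ($g,h\in G$), product $(e_g\bowtie h)(e_{g'}\bowtie h')=\delta_{g,\,hg'h^{-1}}\,e_g\bowtie hh'$, unit $\sum_{g\in G}e_g\bowtie 1$, coproduct $\Delta(e_g\bowtie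 h)=\sum_{uv=g}(e_v\bowtie h)\otimes(e_u\bowtie h)$, counit $\varepsilon(e_g\bowtie h)=\delta_{g,1}$ and antipode $S(e_g\bowtie h)=e_{h^{-1}g^{-1}h}\bowtie h^{-1}$. Then the dual Hopf algebra $D(G)^*$ is a quantum permutation algebra, and $d(D(G)^*)\le |G|^3$. -/

import Mathlib

open scoped TensorProduct

/-- `x` is a magic matrix: the entries of each row and of each column are pairwise orthogonal
idempotents with sum `1`. -/
structure IsMagic {n : ℕ} {B : Type*} [Semiring B] (x : Fin n → Fin n → B) : Prop where
  row : ∀ i j l, x i j * x i l = if j = l then x i j else 0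
  col : ∀ i j l, x i j * x l j = if i = l then x i j else 0
  row_sum : ∀ i, ∑ l, x i l = 1
  col_sum : ∀ i, ∑ l, x l i = 1

namespace QuantumSymmetric

/-- The defining relations of `𝒜ₛ(n)` on the free algebra with generators indexed by pairs
`(i, j)`: the generators form a magic matrix. -/
inductive Rel (k : Type*) [CommRing k] (n : ℕ) :
    FreeAlgebra k (Fin n × Fin n) → FreeAlgebra k (Fin n × Fin n) → Prop
  | row (i j l : Fin n) : Rel k n (FreeAlgebra.ι k (i, j) * FreeAlgebra.ι k (i, l))
      (if j = l then FreeAlgebra.ι k (i, j) else 0)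
  | col (i j l : Fin n) : Rel k n (FreeAlgebra.ι k (i, j) * FreeAlgebra.ι k (l, j))
      (if i = l then FreeAlgebra.ι k (i, j) else 0)
  | row_sum (i : Fin n) : Rel k n (∑ l, FreeAlgebra.ι k (i, l)) 1
  | col_sum (i : Fin n) : Rel k n (∑ l, FreeAlgebra.ι k (l, i)) 1

end QuantumSymmetric

/-- Wang's algebra `𝒜ₛ(n) = 𝒜ₛ(n, k)`: the `k`-algebra presented by generators `u i j`,
`i, j ∈ {1, …, n}`, and the relations saying that `(u i j)` is a magic matrix. -/
def QuantumSymmetric (k : Type*) [CommRing k] (n : ℕ) : Type _ :=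
  RingQuot (QuantumSymmetric.Rel k n)

namespace QuantumSymmetric

variable (k : Type*) [CommRing k] (n : ℕ)

noncomputable instance : Ring (QuantumSymmetric k n) :=
  inferInstanceAs (Ring (RingQuot (Rel k n)))

noncomputable instance : Algebra k (QuantumSymmetric k n) :=
  inferInstanceAs (Algebra k (RingQuot (Rel k n)))

/-- The quotient map from the free algebra. -/
noncomputable def mk : FreeAlgebra k (Fin n × Fin n) →ₐ[k] QuantumSymmetric k n :=
  RingQuot.mkAlgHom k (Rel k n)

/-- The generators `u i j`. -/
noncomputable def u (i j : Fin n) : QuantumSymmetric k n := mk k n (FreeAlgebra.ι k (i, j))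

theorem mk_surjective : Function.Surjective (mk k n) := RingQuot.mkAlgHom_surjective k _

theorem isMagic_u : IsMagic (u k n) where
  row i j l := by
    have h := RingQuot.mkAlgHom_rel k (Rel.row (k := k) i j l)
    rw [map_mul, apply_ite (RingQuot.mkAlgHom k (Rel k n)), map_zero] at h
    exact h
  col i j l := by
    have h := RingQuot.mkAlgHom_rel k (Rel.col (k := k) i j l)
    rw [map_mul, apply_ite (RingQuot.mkAlgHom k (Rel k n)), map_zero] at h
    exact h
  row_sum i := by
    have h := RingQuot.mkAlgHom_rel k (Rel.row_sum (k := k) i)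
    rw [map_sum, map_one] at h
    exact h
  col_sum i := by
    have h := RingQuot.mkAlgHom_rel k (Rel.col_sum (k := k) i)
    rw [map_sum, map_one] at h
    exact h

variable {k n} {B : Type*} [Ring B] [Algebra k B]

/-- Universal property: a magic matrix in `B` gives an algebra map from `𝒜ₛ(n)`. -/
noncomputable def lift (x : Fin n → Fin n → B) (hx : IsMagic x) : QuantumSymmetric k n →ₐ[k] B :=
  RingQuot.liftAlgHom k ⟨FreeAlgebra.lift k fun p => x p.1 p.2, by
    intro a b h
    induction h with
    | row i j l => simpa [apply_ite] using hx.row i j l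
    | col i j l => simpa [apply_ite] using hx.col i j l
    | row_sum i => simpa using hx.row_sum i
    | col_sum i => simpa using hx.col_sum i⟩

@[simp] theorem lift_u (x : Fin n → Fin n → B) (hx : IsMagic x) (i j : Fin n) :
    lift (k := k) x hx (u k n i j) = x i j := by
  refine (RingQuot.liftAlgHom_mkAlgHom_apply k _ _ _).trans ?_
  simp

@[ext] theorem algHom_ext {f g : QuantumSymmetric k n →ₐ[k] B}
    (h : ∀ i j, f (u k n i j) = g (u k n i j)) : f = g := by
  refine RingQuot.ringQuot_ext' k f g (FreeAlgebra.hom_ext ?_)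
  funext p
  exact h p.1 p.2

@[elab_as_elim] theorem induction {C : QuantumSymmetric k n → Prop}
    (algebraMap : ∀ r : k, C (algebraMap k _ r)) (gen : ∀ i j, C (u k n i j))
    (mul : ∀ a b, C a → C b → C (a * b)) (add : ∀ a b, C a → C b → C (a + b))
    (a : QuantumSymmetric k n) : C a := by
  obtain ⟨a, rfl⟩ := mk_surjective k n a
  induction a with
  | grade0 r => simpa using algebraMap r
  | grade1 p => exact gen p.1 p.2
  | mul a b ha hb => simpa using mul _ _ ha hb
  | add a b ha hb => simpa using add _ _ ha hb

variable (k n)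

/-- The comultiplication as an algebra map: `u i j ↦ ∑ l, u i l ⊗ u l j`. -/
noncomputable def comulHom :
    QuantumSymmetric k n →ₐ[k] QuantumSymmetric k n ⊗[k] QuantumSymmetric k n :=
  lift (fun i j => ∑ l, u k n i l ⊗ₜ[k] u k n l j)
    { row := fun i j l => by
        simp only [Finset.sum_mul_sum, Algebra.TensorProduct.tmul_mul_tmul, (isMagic_u k n).row,
          TensorProduct.ite_tmul, Finset.sum_ite_eq, Finset.mem_univ,
          if_true]
        split_ifs <;> simp
      col := fun i j l => by
        rw [Finset.sum_mul_sum]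
        simp only [Algebra.TensorProduct.tmul_mul_tmul, (isMagic_u k n).col,
          TensorProduct.tmul_ite, Finset.sum_ite_eq, Finset.mem_univ,
          if_true]
        split_ifs <;> simp
      row_sum := fun i => by
        rw [Finset.sum_comm]
        simp only [← TensorProduct.tmul_sum, (isMagic_u k n).row_sum]
        rw [← TensorProduct.sum_tmul, (isMagic_u k n).row_sum]; rfl
      col_sum := fun i => by
        rw [Finset.sum_comm]
        simp only [← TensorProduct.sum_tmul, (isMagic_u k n).col_sum]
        rw [← TensorProduct.tmul_sum, (isMagic_u k n).col_sum]; rfl }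

/-- The counit: `u i j ↦ δ i j`. -/
noncomputable def counitHom : QuantumSymmetric k n →ₐ[k] k :=
  lift (fun i j => if i = j then 1 else 0)
    { row := fun i j l => by split_ifs <;> simp_all
      col := fun i j l => by split_ifs <;> simp_all
      row_sum := fun i => by simp
      col_sum := fun i => by simp }

/-- The antipode as an algebra map to the opposite algebra: `u i j ↦ u j i`. -/
noncomputable def antipodeHom : QuantumSymmetric k n →ₐ[k] (QuantumSymmetric k n)ᵐᵒᵖ :=
  lift (fun i j => MulOpposite.op (u k n j i))
    { row := fun i j l => by
        rw [← MulOpposite.op_mul, (isMagic_u k n).col]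
        split_ifs <;> simp_all
      col := fun i j l => by
        rw [← MulOpposite.op_mul, (isMagic_u k n).row]
        split_ifs <;> simp_all
      row_sum := fun i => by
        rw [← Finset.op_sum, (isMagic_u k n).col_sum, MulOpposite.op_one]
      col_sum := fun i => by
        rw [← Finset.op_sum, (isMagic_u k n).row_sum, MulOpposite.op_one] }

@[simp] theorem comulHom_u (i j : Fin n) :
    comulHom k n (u k n i j) = ∑ l, u k n i l ⊗ₜ[k] u k n l j := lift_u _ _ _ _

@[simp] theorem counitHom_u (i j : Fin n) :
    counitHom k n (u k n i j) = if i = j then 1 else 0 := lift_u _ _ _ _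

@[simp] theorem antipodeHom_u (i j : Fin n) :
    antipodeHom k n (u k n i j) = MulOpposite.op (u k n j i) := lift_u _ _ _ _

noncomputable instance : Bialgebra k (QuantumSymmetric k n) :=
  Bialgebra.ofAlgHom (comulHom k n) (counitHom k n)
    (by
      ext i j
      simp only [AlgHom.comp_apply, comulHom_u, map_sum, Algebra.TensorProduct.map_tmul,
        TensorProduct.sum_tmul, TensorProduct.tmul_sum, AlgHom.id_apply]
      rw [Finset.sum_comm]
      simp)
    (by
      ext i j
      simp [TensorProduct.ite_tmul])
    (by
      ext i j
      simp [TensorProduct.tmul_ite])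

/-- The antipode of `𝒜ₛ(n)` as a linear map. -/
noncomputable def antipodeLin : QuantumSymmetric k n →ₗ[k] QuantumSymmetric k n :=
  (MulOpposite.opLinearEquiv k).symm.toLinearMap ∘ₗ (antipodeHom k n).toLinearMap

@[simp] theorem antipodeLin_u (i j : Fin n) : antipodeLin k n (u k n i j) = u k n j i := by
  simp [antipodeLin]

theorem antipodeLin_mul (a b : QuantumSymmetric k n) :
    antipodeLin k n (a * b) = antipodeLin k n b * antipodeLin k n a := by
  simp [antipodeLin]

theorem antipodeLin_algebraMap (r : k) :
    antipodeLin k n (algebraMap k _ r) = algebraMap k _ r := by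
  simp [antipodeLin]

theorem comul_u (i j : Fin n) :
    Coalgebra.comul (R := k) (u k n i j) = ∑ l, u k n i l ⊗ₜ[k] u k n l j := comulHom_u k n i j

theorem counit_u (i j : Fin n) :
    Coalgebra.counit (R := k) (u k n i j) = if i = j then 1 else 0 := counitHom_u k n i j

theorem antipodeLin_one : antipodeLin k n 1 = 1 := by
  simpa using antipodeLin_algebraMap k n 1

theorem mul_rTensor_antipodeLin (x : QuantumSymmetric k n ⊗[k] QuantumSymmetric k n)
    (c d : QuantumSymmetric k n) :
    LinearMap.mul' k _ ((antipodeLin k n).rTensor _ (x * (c ⊗ₜ[k] d))) =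
      antipodeLin k n c * LinearMap.mul' k _ ((antipodeLin k n).rTensor _ x) * d := by
  induction x with
  | zero => simp
  | tmul a b => simp [antipodeLin_mul, mul_assoc]
  | add x y hx hy => simp only [add_mul, mul_add, map_add, hx, hy]

theorem mul_lTensor_antipodeLin (x : QuantumSymmetric k n ⊗[k] QuantumSymmetric k n)
    (c d : QuantumSymmetric k n) :
    LinearMap.mul' k _ ((antipodeLin k n).lTensor _ ((c ⊗ₜ[k] d) * x)) =
      c * LinearMap.mul' k _ ((antipodeLin k n).lTensor _ x) * antipodeLin k n d := by
  induction x with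
  | zero => simp
  | tmul a b => simp [antipodeLin_mul, mul_assoc]
  | add x y hx hy => simp only [add_mul, mul_add, map_add, hx, hy]

open Coalgebra in
noncomputable instance : HopfAlgebra k (QuantumSymmetric k n) where
  antipode := antipodeLin k n
  mul_antipode_rTensor_comul := by
    ext a
    simp only [LinearMap.comp_apply, Algebra.linearMap_apply]
    induction a using induction with
    | algebraMap r =>
      simp [Algebra.TensorProduct.algebraMap_apply, antipodeLin_algebraMap]
    | gen i j =>
      simp only [comul_u, counit_u, map_sum, LinearMap.rTensor_tmul, antipodeLin_u,
        LinearMap.mul'_apply, (isMagic_u k n).row]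
      split_ifs <;> simp [(isMagic_u k n).col_sum]
    | mul a b ha hb =>
      rw [Bialgebra.comul_mul, Bialgebra.counit_mul, map_mul (algebraMap k _), ← hb]
      generalize comul (R := k) b = y
      induction y with
      | zero => simp
      | tmul c d =>
        rw [mul_rTensor_antipodeLin, ha, ← Algebra.commutes, mul_assoc]
        simp
      | add x y hx hy => simp only [mul_add, map_add, hx, hy]
    | add a b ha hb => simp only [map_add, ha, hb]
  mul_antipode_lTensor_comul := by
    ext a
    simp only [LinearMap.comp_apply, Algebra.linearMap_apply]
    induction a using induction with
    | algebraMap r =>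
      simp [Algebra.TensorProduct.algebraMap_apply, antipodeLin_one]
    | gen i j =>
      simp only [comul_u, counit_u, map_sum, LinearMap.lTensor_tmul, antipodeLin_u,
        LinearMap.mul'_apply, (isMagic_u k n).col]
      split_ifs <;> simp [(isMagic_u k n).row_sum]
    | mul a b ha hb =>
      rw [Bialgebra.comul_mul, Bialgebra.counit_mul, mul_comm, map_mul (algebraMap k _), ← ha]
      generalize comul (R := k) a = y
      induction y with
      | zero => simp
      | tmul c d =>
        rw [mul_lTensor_antipodeLin, hb, ← Algebra.commutes, mul_assoc]
        simp
      | add x y hx hy => simp only [mul_add, add_mul, map_add, hx, hy]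
    | add a b ha hb => simp only [map_add, ha, hb]

end QuantumSymmetric

/-- The underlying space of the Drinfeld double `D(G) = (k^G)^cop ⋈ kG` of the group algebra of a
finite group `G`: the free `k`-module with basis the elements `e g h` (that is, `e_g ⋈ h`, where
`e_g ∈ k^G` is the indicator function of `g`, and `h ∈ G`). -/
def DrinfeldDouble (k G : Type*) [CommRing k] : Type _ := (G × G) →₀ k

namespace DrinfeldDouble

variable (k G : Type*) [CommRing k]

noncomputable instance : AddCommGroup (DrinfeldDouble k G) :=
  inferInstanceAs (AddCommGroup ((G × G) →₀ k))

noncomputable instance : Module k (DrinfeldDouble k G) :=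
  inferInstanceAs (Module k ((G × G) →₀ k))

variable {G}

/-- The basis element `e_g ⋈ h`. -/
noncomputable def e (g h : G) : DrinfeldDouble k G := Finsupp.single (g, h) 1

variable {k} in
/-- The linear map with prescribed values on the basis. -/
noncomputable def ofBasis {M : Type*} [AddCommGroup M] [Module k M] (f : G → G → M) :
    DrinfeldDouble k G →ₗ[k] M :=
  Finsupp.linearCombination k (fun p : G × G => f p.1 p.2)

variable {k} in
@[simp] theorem ofBasis_e {M : Type*} [AddCommGroup M] [Module k M] (f : G → G → M) (g h : G) :
    ofBasis f (e k g h) = f g h := by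
  refine (Finsupp.linearCombination_single k (1 : k) (g, h)).trans ?_
  simp

variable {k} in
@[ext] theorem hom_ext {M : Type*} [AddCommGroup M] [Module k M]
    {f f' : DrinfeldDouble k G →ₗ[k] M} (H : ∀ g h, f (e k g h) = f' (e k g h)) : f = f' :=
  Finsupp.lhom_ext' fun p => LinearMap.ext_ring (H p.1 p.2)

instance [Finite G] : Module.Finite k (DrinfeldDouble k G) :=
  inferInstanceAs (Module.Finite k ((G × G) →₀ k))

variable {k} in
@[elab_as_elim] theorem induction {P : DrinfeldDouble k G → Prop}
    (basis : ∀ g h, P (e k g h)) (add : ∀ a b, P a → P b → P (a + b))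
    (smul : ∀ (r : k) a, P a → P (r • a)) (zero : P 0) (a : DrinfeldDouble k G) : P a := by
  refine Finsupp.induction_linear (motive := P) a zero add fun p r => ?_
  have h := smul r _ (basis p.1 p.2)
  have h' : (Finsupp.single p r : (G × G) →₀ k) = r • Finsupp.single p 1 := by simp
  rw [h']
  exact h

variable [Group G] [DecidableEq G]

/-- The multiplication of `D(G)`: `(e_g ⋈ h) (e_g' ⋈ h') = δ_{g, h g' h⁻¹} e_g ⋈ h h'`. -/
noncomputable def mulLin : DrinfeldDouble k G →ₗ[k] DrinfeldDouble k G →ₗ[k] DrinfeldDouble k G :=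
  ofBasis fun g h => ofBasis fun g' h' =>
    if g = h * g' * h⁻¹ then e k g (h * h') else 0

noncomputable instance : Mul (DrinfeldDouble k G) := ⟨fun a b => mulLin k a b⟩

theorem mul_def (a b : DrinfeldDouble k G) : a * b = mulLin k a b := rfl

@[simp] theorem e_mul_e (g h g' h' : G) :
    e k g h * e k g' h' = if g = h * g' * h⁻¹ then e k g (h * h') else 0 := by
  simp [mul_def, mulLin]

theorem smul_mul_aux (r : k) (a b : DrinfeldDouble k G) : (r • a) * b = r • (a * b) :=
  LinearMap.map_smul₂ (mulLin k) r a b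

theorem mul_smul_aux (r : k) (a b : DrinfeldDouble k G) : a * (r • b) = r • (a * b) :=
  map_smul (mulLin k a) r b

noncomputable instance : NonUnitalNonAssocRing (DrinfeldDouble k G) :=
  { (inferInstance : AddCommGroup (DrinfeldDouble k G)) with
    mul := (· * ·)
    left_distrib := fun a b c => map_add (mulLin k a) b c
    right_distrib := fun a b c => LinearMap.map_add₂ (mulLin k) a b c
    zero_mul := fun a => LinearMap.map_zero₂ (mulLin k) a
    mul_zero := fun a => map_zero (mulLin k a) }

theorem mul_assoc_aux (a b c : DrinfeldDouble k G) : a * b * c = a * (b * c) := by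
  induction a using induction with
  | zero => simp only [zero_mul]
  | add a a' h h' => simp only [add_mul, h, h']
  | smul r a h => simp only [smul_mul_aux, h]
  | basis g₁ h₁ =>
    induction b using induction with
    | zero => simp only [zero_mul, mul_zero]
    | add a a' h h' => simp only [add_mul, mul_add, h, h']
    | smul r a h => simp only [smul_mul_aux, mul_smul_aux, h]
    | basis g₂ h₂ =>
      induction c using induction with
      | zero => simp only [mul_zero]
      | add a a' h h' => simp only [mul_add, h, h']
      | smul r a h => simp only [mul_smul_aux, h]
      | basis g₃ h₃ =>
        by_cases h : g₁ = h₁ * g₂ * h₁⁻¹ <;> by_cases h' : g₂ = h₂ * g₃ * h₂⁻¹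
        · subst h'; subst h; simp [mul_assoc]
        · have : ¬ g₁ = h₁ * h₂ * g₃ * (h₁ * h₂)⁻¹ := by
            subst h
            intro h''
            apply h'
            have h3 : h₁ * g₂ * h₁⁻¹ = h₁ * (h₂ * g₃ * h₂⁻¹) * h₁⁻¹ := by
              rw [h'']; group
            exact mul_left_cancel (mul_right_cancel h3)
          rw [e_mul_e, if_pos h, e_mul_e, if_neg this, e_mul_e, if_neg h', mul_zero]
        · rw [e_mul_e, if_neg h, zero_mul, e_mul_e, if_pos h', e_mul_e, if_neg h]
        · rw [e_mul_e, if_neg h, zero_mul, e_mul_e, if_neg h', mul_zero]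

variable [Fintype G]

/-- The unit of `D(G)` is `∑ g, e_g ⋈ 1`. -/
noncomputable instance : One (DrinfeldDouble k G) := ⟨∑ g, e k g 1⟩

theorem one_def : (1 : DrinfeldDouble k G) = ∑ g, e k g 1 := rfl

theorem one_mul_aux (a : DrinfeldDouble k G) : 1 * a = a := by
  induction a using induction with
  | zero => simp only [mul_zero]
  | add a a' h h' => simp only [mul_add, h, h']
  | smul r a h => simp only [mul_smul_aux, h]
  | basis g h => simp [one_def, Finset.sum_mul]

theorem mul_one_aux (a : DrinfeldDouble k G) : a * 1 = a := by
  induction a using induction with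
  | zero => simp only [zero_mul]
  | add a a' h h' => simp only [add_mul, h, h']
  | smul r a h => simp only [smul_mul_aux, h]
  | basis g h =>
    have : ∀ x : G, g = h * x * h⁻¹ ↔ x = h⁻¹ * g * h := fun x => by
      constructor <;> rintro rfl <;> group
    simp [one_def, Finset.mul_sum, this]

noncomputable instance : Ring (DrinfeldDouble k G) :=
  { (inferInstance : NonUnitalNonAssocRing (DrinfeldDouble k G)) with
    one := 1
    mul_assoc := mul_assoc_aux k
    one_mul := one_mul_aux k
    mul_one := mul_one_aux k }

noncomputable instance : Algebra k (DrinfeldDouble k G) :=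
  Algebra.ofModule (smul_mul_aux k) (mul_smul_aux k)

/-- The comultiplication of `D(G)`: `Δ(e_g ⋈ h) = ∑_{u v = g} (e_v ⋈ h) ⊗ (e_u ⋈ h)`. -/
noncomputable def comulLin : DrinfeldDouble k G →ₗ[k] DrinfeldDouble k G ⊗[k] DrinfeldDouble k G :=
  ofBasis fun g h => ∑ u : G, e k (u⁻¹ * g) h ⊗ₜ[k] e k u h

/-- The counit of `D(G)`: `ε(e_g ⋈ h) = δ_{g, 1}`. -/
noncomputable def counitLin : DrinfeldDouble k G →ₗ[k] k :=
  ofBasis fun g _ => if g = 1 then 1 else 0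

/-- The antipode of `D(G)`: `S(e_g ⋈ h) = e_{h⁻¹ g⁻¹ h} ⋈ h⁻¹`. -/
noncomputable def antipodeLin : DrinfeldDouble k G →ₗ[k] DrinfeldDouble k G :=
  ofBasis fun g h => e k (h⁻¹ * g⁻¹ * h) h⁻¹

noncomputable instance : Coalgebra k (DrinfeldDouble k G) where
  comul := comulLin k
  counit := counitLin k
  coassoc := by
    ext g h
    simp only [LinearMap.comp_apply, comulLin, ofBasis_e, map_sum, LinearMap.rTensor_tmul,
      LinearMap.lTensor_tmul, TensorProduct.sum_tmul, TensorProduct.tmul_sum,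
      LinearEquiv.coe_coe, TensorProduct.assoc_tmul]
    conv_rhs => rw [Finset.sum_comm]
    refine Finset.sum_congr rfl fun w _ => Fintype.sum_equiv (Equiv.mulLeft w) _ _ fun v => ?_
    simp [mul_assoc]
  rTensor_counit_comp_comul := by
    ext g h
    simp [comulLin, counitLin, TensorProduct.ite_tmul, inv_mul_eq_one]
  lTensor_counit_comp_comul := by
    ext g h
    simp [comulLin, counitLin, TensorProduct.tmul_ite]

theorem comul_e (g h : G) :
    Coalgebra.comul (R := k) (e k g h) = ∑ u : G, e k (u⁻¹ * g) h ⊗ₜ[k] e k u h := ofBasis_e _ _ _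

theorem counit_e (g h : G) :
    Coalgebra.counit (R := k) (e k g h) = if g = 1 then 1 else 0 := ofBasis_e _ _ _

theorem counit_mul_aux (a b : DrinfeldDouble k G) :
    Coalgebra.counit (R := k) (a * b) = Coalgebra.counit a * Coalgebra.counit (R := k) b := by
  induction a using induction with
  | zero => simp only [zero_mul, map_zero]
  | add a a' h h' => simp only [add_mul, map_add, h, h']
  | smul r a h => simp only [smul_mul_aux, map_smul, h, smul_eq_mul, mul_assoc]
  | basis g h =>
    induction b using induction with
    | zero => simp only [mul_zero, map_zero]
    | add a a' h h' => simp only [mul_add, map_add, h, h']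
    | smul r a h => simp only [mul_smul_aux, map_smul, h, smul_eq_mul, mul_left_comm]
    | basis g' h' =>
      rw [e_mul_e]
      by_cases h1 : g' = 1
      · subst h1
        by_cases h2 : g = 1 <;> simp [counit_e, h2]
      · by_cases h2 : g = 1
        · subst h2
          have : ¬ 1 = h * g' * h⁻¹ := fun H => h1 (by simpa using conj_eq_one_iff.mp H.symm)
          simp [counit_e, h1, this]
        · split_ifs <;> simp [counit_e, h2]

theorem comul_mul_aux (a b : DrinfeldDouble k G) :
    Coalgebra.comul (R := k) (a * b) = Coalgebra.comul a * Coalgebra.comul (R := k) b := by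
  induction a using induction with
  | zero => simp only [zero_mul, map_zero]
  | add a a' h h' => simp only [add_mul, map_add, h, h']
  | smul r a h => simp only [map_smul, h, smul_mul_assoc]
  | basis g h =>
    induction b using induction with
    | zero => simp only [mul_zero, map_zero]
    | add a a' h h' => simp only [mul_add, map_add, h, h']
    | smul r a h => simp only [map_smul, h, mul_smul_comm]
    | basis g' h' =>
      rw [e_mul_e, comul_e, comul_e, Finset.sum_mul_sum]
      simp only [Algebra.TensorProduct.tmul_mul_tmul, e_mul_e]
      have key : ∀ u v : G, u = h * v * h⁻¹ ↔ v = h⁻¹ * u * h := fun u v => by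
        constructor <;> rintro rfl <;> group
      have key' : ∀ u : G, u⁻¹ * g = h * ((h⁻¹ * u * h)⁻¹ * g') * h⁻¹ ↔ g = h * g' * h⁻¹ :=
        fun u => by
          rw [show h * ((h⁻¹ * u * h)⁻¹ * g') * h⁻¹ = u⁻¹ * (h * g' * h⁻¹) by group,
            mul_right_inj]
      have inner : ∀ u : G, (∑ v : G, (if u⁻¹ * g = h * (v⁻¹ * g') * h⁻¹ then
            e k (u⁻¹ * g) (h * h') else 0) ⊗ₜ[k]
              (if u = h * v * h⁻¹ then e k u (h * h') else 0)) =
          if g = h * g' * h⁻¹ then e k (u⁻¹ * g) (h * h') ⊗ₜ[k] e k u (h * h') else 0 := by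
        intro u
        rw [Finset.sum_eq_single (h⁻¹ * u * h)]
        · rw [if_pos ((key u _).2 rfl)]
          by_cases hg : g = h * g' * h⁻¹
          · rw [if_pos ((key' u).2 hg), if_pos hg]
          · rw [if_neg (mt (key' u).1 hg), if_neg hg, TensorProduct.zero_tmul]
        · intro v _ hv
          rw [if_neg (mt (key u v).1 hv), TensorProduct.tmul_zero]
        · exact fun H => absurd (Finset.mem_univ _) H
      simp only [inner]
      split_ifs
      · exact comul_e k _ _
      · simp

noncomputable instance : Bialgebra k (DrinfeldDouble k G) :=
  Bialgebra.mk' k _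
    (by simp [one_def, counit_e])
    (counit_mul_aux k _ _)
    (by
      simp only [one_def, map_sum, comul_e, Algebra.TensorProduct.one_def,
        TensorProduct.sum_tmul, TensorProduct.tmul_sum]
      rw [Finset.sum_comm]
      exact Finset.sum_congr rfl fun u _ =>
        Fintype.sum_equiv (Equiv.mulLeft u⁻¹) _ _ fun g => rfl)
    (comul_mul_aux k _ _)

noncomputable instance : HopfAlgebra k (DrinfeldDouble k G) where
  antipode := antipodeLin k
  mul_antipode_rTensor_comul := by
    ext g h
    simp only [LinearMap.comp_apply, comul_e, counit_e, map_sum, LinearMap.rTensor_tmul,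
      antipodeLin, ofBasis_e, LinearMap.mul'_apply, e_mul_e]
    have key : ∀ u : G, h⁻¹ * (u⁻¹ * g)⁻¹ * h = h⁻¹ * u * h⁻¹⁻¹ ↔ g = 1 := fun u => by
      simp
    simp only [key]
    by_cases hg : g = 1
    · subst hg
      simp only [if_true, inv_mul_cancel, mul_one, inv_inv, Algebra.linearMap_apply, map_one,
        one_def]
      exact Fintype.sum_equiv (MulAut.conj h⁻¹).toEquiv _ _ fun u => by simp
    · simp [hg]
  mul_antipode_lTensor_comul := by
    ext g h
    simp only [LinearMap.comp_apply, comul_e, counit_e, map_sum, LinearMap.lTensor_tmul,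
      antipodeLin, ofBasis_e, LinearMap.mul'_apply, e_mul_e]
    have key : ∀ u : G, u⁻¹ * g = h * (h⁻¹ * u⁻¹ * h) * h⁻¹ ↔ g = 1 := fun u => by
      rw [show h * (h⁻¹ * u⁻¹ * h) * h⁻¹ = u⁻¹ by group, mul_eq_left]
    simp only [key]
    by_cases hg : g = 1
    · subst hg
      simp only [if_true, mul_inv_cancel, mul_one, Algebra.linearMap_apply, map_one, one_def]
      exact Fintype.sum_equiv (Equiv.inv G) _ _ fun u => by simp
    · simp [hg]
end DrinfeldDouble

/-- The dual Hopf algebra `H*` of a finite-dimensional Hopf algebra `H`. Its algebra structure is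
the convolution product of linear forms, with unit the counit of `H`; its comultiplication, counit
and antipode are the transposes of the multiplication, unit and antipode of `H`. -/
def HopfDual (k H : Type*) [Field k] [AddCommGroup H] [Module k H] : Type _ :=
  WithConv (H →ₗ[k] k)

namespace HopfDual
open WithConv Coalgebra

variable (k H : Type*) [Field k] [Ring H] [HopfAlgebra k H]

noncomputable instance : Ring (HopfDual k H) :=
  inferInstanceAs (Ring (WithConv (H →ₗ[k] k)))

noncomputable instance : Algebra k (HopfDual k H) :=
  inferInstanceAs (Algebra k (WithConv (H →ₗ[k] k)))

/-- The identification of the dual Hopf algebra with the dual space. -/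
noncomputable def toDual : HopfDual k H ≃ₗ[k] (H →ₗ[k] k) where
  toFun φ := WithConv.ofConv φ
  invFun φ := WithConv.toConv φ
  left_inv _ := rfl
  right_inv _ := rfl
  map_add' _ _ := rfl
  map_smul' _ _ := rfl

variable {k H}

theorem dual_ext {φ ψ : HopfDual k H} (h : ∀ a, toDual k H φ a = toDual k H ψ a) : φ = ψ :=
  (toDual k H).injective (LinearMap.ext h)

theorem mul_apply' (φ ψ : HopfDual k H) (a : H) : toDual k H (φ * ψ) a =
    LinearMap.mul' k k (TensorProduct.map (toDual k H φ) (toDual k H ψ) (comul a)) := rfl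

theorem mul_apply {ι : Type*} {a : H} (r : Coalgebra.Repr k a ι) (φ ψ : HopfDual k H) :
    toDual k H (φ * ψ) a = ∑ i ∈ r.index, toDual k H φ (r.left i) * toDual k H ψ (r.right i) :=
  r.convMul_apply _ _

@[simp] theorem one_apply (a : H) : toDual k H 1 a = counit a := rfl

variable (k H) [FiniteDimensional k H]

/-- The canonical isomorphism `H* ⊗ H* ≃ (H ⊗ H)*` for finite-dimensional `H`. -/
noncomputable def tensorEquiv :
    HopfDual k H ⊗[k] HopfDual k H ≃ₗ[k] (H ⊗[k] H →ₗ[k] k) :=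
  (TensorProduct.congr (toDual k H) (toDual k H)) ≪≫ₗ
    (homTensorHomEquiv k H H k k) ≪≫ₗ
      LinearEquiv.congrRight (TensorProduct.lid k k)

variable {k H}

@[simp] theorem tensorEquiv_tmul (φ ψ : HopfDual k H) (a b : H) :
    tensorEquiv k H (φ ⊗ₜ ψ) (a ⊗ₜ b) = toDual k H φ a * toDual k H ψ b := by
  simp [tensorEquiv, LinearEquiv.congrRight]

variable (k H)

/-- The comultiplication of `H*`: the transpose `H* → (H ⊗ H)* ≃ H* ⊗ H*` of the multiplication. -/
noncomputable def comulLin : HopfDual k H →ₗ[k] HopfDual k H ⊗[k] HopfDual k H :=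
  (tensorEquiv k H).symm.toLinearMap ∘ₗ
    (LinearMap.mul' k H).dualMap ∘ₗ (toDual k H).toLinearMap

/-- The counit of `H*`: evaluation at `1`. -/
noncomputable def counitLin : HopfDual k H →ₗ[k] k :=
  LinearMap.applyₗ (1 : H) ∘ₗ (toDual k H).toLinearMap

/-- The antipode of `H*`: the transpose of the antipode of `H`. -/
noncomputable def antipodeLin : HopfDual k H →ₗ[k] HopfDual k H :=
  (toDual k H).symm.toLinearMap ∘ₗ
    (HopfAlgebra.antipode k (A := H)).dualMap ∘ₗ (toDual k H).toLinearMap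

variable {k H}

theorem tensorEquiv_comulLin (φ : HopfDual k H) (a b : H) :
    tensorEquiv k H (comulLin k H φ) (a ⊗ₜ b) = toDual k H φ (a * b) := by
  simp [comulLin]

theorem counitLin_apply (φ : HopfDual k H) : counitLin k H φ = toDual k H φ 1 := rfl

theorem antipodeLin_apply (φ : HopfDual k H) (a : H) :
    toDual k H (antipodeLin k H φ) a = toDual k H φ (HopfAlgebra.antipode k a) := rfl

theorem tensor_ext {x y : HopfDual k H ⊗[k] HopfDual k H}
    (h : ∀ a b, tensorEquiv k H x (a ⊗ₜ b) = tensorEquiv k H y (a ⊗ₜ b)) : x = y :=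
  (tensorEquiv k H).injective (TensorProduct.ext' h)

/-- Evaluation of a triple tensor. -/
noncomputable def eval₃ (a b c : H) : HopfDual k H ⊗[k] (HopfDual k H ⊗[k] HopfDual k H) →ₗ[k] k :=
  TensorProduct.lid k k ∘ₗ TensorProduct.map
    (LinearMap.applyₗ a ∘ₗ (toDual k H).toLinearMap)
    (LinearMap.applyₗ (b ⊗ₜ[k] c) ∘ₗ (tensorEquiv k H).toLinearMap)

theorem eval₃_tmul (a b c : H) (φ : HopfDual k H) (x : HopfDual k H ⊗[k] HopfDual k H) :
    eval₃ a b c (φ ⊗ₜ x) = toDual k H φ a * tensorEquiv k H x (b ⊗ₜ c) := by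
  simp [eval₃]

theorem tensor_ext₃ {x y : HopfDual k H ⊗[k] (HopfDual k H ⊗[k] HopfDual k H)}
    (h : ∀ a b c, eval₃ a b c x = eval₃ a b c y) : x = y := by
  let E := TensorProduct.congr (toDual k H) (tensorEquiv k H) ≪≫ₗ
    (homTensorHomEquiv k H (H ⊗[k] H) k k) ≪≫ₗ LinearEquiv.congrRight (TensorProduct.lid k k)
  have hE : ∀ z a b c, E z (a ⊗ₜ (b ⊗ₜ c)) = eval₃ a b c z := by
    intro z a b c
    induction z with
    | zero => simp
    | tmul φ x => simp [E, eval₃, LinearEquiv.congrRight]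
    | add x y hx hy => simp only [map_add, LinearMap.add_apply, hx, hy]
  refine E.injective (TensorProduct.ext (LinearMap.ext fun a => TensorProduct.ext' fun b c => ?_))
  simpa [hE] using h a b c

noncomputable instance : Coalgebra k (HopfDual k H) where
  comul := comulLin k H
  counit := counitLin k H
  coassoc := by
    ext1 φ
    apply tensor_ext₃
    intro a b c
    have h1 : ∀ x : HopfDual k H ⊗[k] HopfDual k H,
        eval₃ a b c (TensorProduct.assoc k _ _ _ ((comulLin k H).rTensor _ x)) =
          tensorEquiv k H x ((a * b) ⊗ₜ c) := by
      intro x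
      induction x with
      | zero => simp
      | add x y hx hy => simp only [map_add, LinearMap.add_apply, hx, hy]
      | tmul φ ψ =>
        rw [LinearMap.rTensor_tmul, tensorEquiv_tmul, ← tensorEquiv_comulLin]
        generalize comulLin k H φ = z
        induction z with
        | zero => simp
        | add x y hx hy =>
          simp only [TensorProduct.add_tmul, map_add, LinearMap.add_apply, hx, hy, add_mul]
        | tmul φ φ' => simp [eval₃_tmul, mul_assoc]
    have h2 : ∀ x : HopfDual k H ⊗[k] HopfDual k H,
        eval₃ a b c ((comulLin k H).lTensor _ x) = tensorEquiv k H x (a ⊗ₜ (b * c)) := by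
      intro x
      induction x with
      | zero => simp
      | add x y hx hy => simp only [map_add, LinearMap.add_apply, hx, hy]
      | tmul φ ψ =>
        rw [LinearMap.lTensor_tmul, tensorEquiv_tmul, eval₃_tmul, tensorEquiv_comulLin]
    simp only [LinearMap.comp_apply, LinearEquiv.coe_coe, h1, h2, tensorEquiv_comulLin, mul_assoc]
  rTensor_counit_comp_comul := by
    ext1 φ
    apply (TensorProduct.lid k (HopfDual k H)).injective
    refine dual_ext fun a => ?_
    have h : ∀ x : HopfDual k H ⊗[k] HopfDual k H,
        toDual k H (TensorProduct.lid k _ ((counitLin k H).rTensor _ x)) a = tensorEquiv k H x (1 ⊗ₜ a) := by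
      intro x
      induction x with
      | zero => simp
      | add x y hx hy =>
        simp only [map_add, LinearMap.add_apply, hx, hy]
      | tmul φ ψ => simp [counitLin_apply]
    simp [h, tensorEquiv_comulLin]
  lTensor_counit_comp_comul := by
    ext1 φ
    apply (TensorProduct.rid k (HopfDual k H)).injective
    refine dual_ext fun a => ?_
    have h : ∀ x : HopfDual k H ⊗[k] HopfDual k H,
        toDual k H (TensorProduct.rid k _ ((counitLin k H).lTensor _ x)) a = tensorEquiv k H x (a ⊗ₜ 1) := by
      intro x
      induction x with
      | zero => simp
      | add x y hx hy =>
        simp only [map_add, LinearMap.add_apply, hx, hy]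
      | tmul φ ψ => simp [counitLin_apply, mul_comm]
    simp [h, tensorEquiv_comulLin]

theorem tensorEquiv_comul (φ : HopfDual k H) (a b : H) :
    tensorEquiv k H (comul φ) (a ⊗ₜ b) = toDual k H φ (a * b) := tensorEquiv_comulLin φ a b

theorem counit_apply (φ : HopfDual k H) : counit (R := k) φ = toDual k H φ 1 := rfl

theorem tensorEquiv_comul' (φ : HopfDual k H) (t : H ⊗[k] H) :
    tensorEquiv k H (comul φ) t = toDual k H φ (LinearMap.mul' k H t) := by
  induction t with
  | zero => simp
  | add x y hx hy => simp only [map_add, hx, hy]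
  | tmul a b => simp [tensorEquiv_comul]

theorem tensorEquiv_mul (x y : HopfDual k H ⊗[k] HopfDual k H) (a b : H) :
    tensorEquiv k H (x * y) (a ⊗ₜ b) = ∑ i ∈ (ℛ k a).index, ∑ j ∈ (ℛ k b).index,
      tensorEquiv k H x ((ℛ k a).left i ⊗ₜ (ℛ k b).left j) *
        tensorEquiv k H y ((ℛ k a).right i ⊗ₜ (ℛ k b).right j) := by
  induction x with
  | zero => simp
  | add x x' hx hx' =>
    simp only [add_mul, map_add, LinearMap.add_apply, hx, hx', Finset.sum_add_distrib]
  | tmul φ φ' =>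
    induction y with
    | zero => simp
    | add y y' hy hy' =>
      simp only [mul_add, map_add, LinearMap.add_apply, hy, hy', Finset.sum_add_distrib]
    | tmul ψ ψ' =>
      rw [Algebra.TensorProduct.tmul_mul_tmul, tensorEquiv_tmul, mul_apply (ℛ k a),
        mul_apply (ℛ k b), Finset.sum_mul_sum]
      exact Finset.sum_congr rfl fun i _ => Finset.sum_congr rfl fun j _ => by
        rw [tensorEquiv_tmul, tensorEquiv_tmul]; ring

noncomputable instance : Bialgebra k (HopfDual k H) :=
  Bialgebra.mk' k _
    (by simp [counit_apply])
    (by intro φ ψ; simp [counit_apply, mul_apply', Algebra.TensorProduct.one_def])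
    (by
      apply tensor_ext
      intro a b
      rw [tensorEquiv_comul, Algebra.TensorProduct.one_def, tensorEquiv_tmul]
      simp)
    (by
      intro φ ψ
      apply tensor_ext
      intro a b
      rw [tensorEquiv_comul, tensorEquiv_mul, mul_apply', Bialgebra.comul_mul,
        ← (ℛ k a).eq, ← (ℛ k b).eq, Finset.sum_mul_sum]
      simp [tensorEquiv_comul])

noncomputable instance : HopfAlgebra k (HopfDual k H) where
  antipode := antipodeLin k H
  mul_antipode_rTensor_comul := by
    ext1 φ
    refine dual_ext fun a => ?_
    have h : ∀ x : HopfDual k H ⊗[k] HopfDual k H,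
        toDual k H (LinearMap.mul' k _ ((antipodeLin k H).rTensor _ x)) a =
          tensorEquiv k H x ((HopfAlgebra.antipode k).rTensor H (comul a)) := by
      intro x
      induction x with
      | zero => simp
      | add x y hx hy =>
        simp only [map_add, LinearMap.add_apply, hx, hy]
      | tmul φ ψ =>
        simp [mul_apply (ℛ k a), ← (ℛ k a).eq, antipodeLin_apply]
    simp only [LinearMap.comp_apply, h, tensorEquiv_comul']
    simp [Algebra.algebraMap_eq_smul_one, counit_apply, mul_comm]
  mul_antipode_lTensor_comul := by
    ext1 φ
    refine dual_ext fun a => ?_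
    have h : ∀ x : HopfDual k H ⊗[k] HopfDual k H,
        toDual k H (LinearMap.mul' k _ ((antipodeLin k H).lTensor _ x)) a =
          tensorEquiv k H x ((HopfAlgebra.antipode k).lTensor H (comul a)) := by
      intro x
      induction x with
      | zero => simp
      | add x y hx hy =>
        simp only [map_add, LinearMap.add_apply, hx, hy]
      | tmul φ ψ =>
        simp [mul_apply (ℛ k a), ← (ℛ k a).eq, antipodeLin_apply]
    simp only [LinearMap.comp_apply, h, tensorEquiv_comul']
    simp [Algebra.algebraMap_eq_smul_one, counit_apply, mul_comm]

end HopfDual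

/-- The Hopf algebra `H` is a quotient Hopf algebra of `𝒜ₛ(n)`: there is a surjective morphism of
Hopf algebras `𝒜ₛ(n) → H`. (A bialgebra morphism between Hopf algebras automatically commutes with
the antipodes.) -/
def IsQuotientOfQuantumSymmetric (k H : Type*) [Field k] [Ring H] [HopfAlgebra k H] (n : ℕ) : Prop :=
  ∃ f : QuantumSymmetric k n →ₐc[k] H, Function.Surjective f

/-- `H` is a quantum permutation algebra: a quotient Hopf algebra of `𝒜ₛ(n)` for some `n ≥ 1`. -/
def IsQuantumPermutationAlgebra (k H : Type*) [Field k] [Ring H] [HopfAlgebra k H] : Prop :=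
  ∃ n : ℕ, 1 ≤ n ∧ IsQuotientOfQuantumSymmetric k H n

/-- The degree `d(H)` of a quantum permutation algebra `H`: the smallest `n ≥ 1` such that `H` is a
quotient Hopf algebra of `𝒜ₛ(n)`. (Only meaningful for quantum permutation algebras.) -/
noncomputable def quantumPermutationDegree (k H : Type*) [Field k] [Ring H] [HopfAlgebra k H] : ℕ :=
  sInf {n : ℕ | 1 ≤ n ∧ IsQuotientOfQuantumSymmetric k H n}

/-! A quotient of `QuantumSymmetric k n` arises from an `n × n` magic matrix over `H` whose entries
comultiply like matrix coefficients, have counit `δ`, and generate `H`; so it suffices to build such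
a matrix of size `|G|^3` over `D(G)*`.

As an algebra `D(G)*` is a product, indexed by `h`, of copies of the opposite group algebra of `G`
(`dualE_mul_dualE`). Put `N = |G|`. For each `c` the map `i ↦ c ^ i` is a homomorphism from `ℤ/N`,
and `k` contains a primitive `N`-th root of unity, so the Fourier transform on `ℤ/N` yields
orthogonal idempotents `fourier ψ c h t` summing over `t` to the unit of the component `h`
(`fourier_mul_fourier`, `sum_fourier`). Comultiplication conjugates `c` to `b⁻¹ * c * b` in the
second leg (`comul_fourier`), so all conjugates of an element `g` have to be carried along. Rows
`(g, y, s)` and columns `(g, x, t)` achieve this: the entry has `c = y g y⁻¹` and `h = y x⁻¹`, so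
that `h⁻¹ c h = x g x⁻¹` is exactly the element attached to the column.

The magic relations follow from orthogonality, and Fourier inversion (`sum_smul_fourier`) recovers
the dual basis from the entries. Each of the three indices takes `N` values. -/

open scoped TensorProduct

/-! ### Quotients of `𝒜ₛ(n)` from magic comatrices -/

section Quotient

variable {k H ι : Type*} [Field k] [Ring H] [HopfAlgebra k H] [Fintype ι] [DecidableEq ι]

/-- A magic comatrix whose coefficients generate `H` exhibits `H` as a quotient of `𝒜ₛ(n)`. -/
theorem IsQuotientOfQuantumSymmetric.of_comatrix (x : ι → ι → H)
    (row : ∀ i j l, x i j * x i l = if j = l then x i j else 0)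
    (col : ∀ i j l, x i j * x l j = if i = l then x i j else 0)
    (row_sum : ∀ i, ∑ l, x i l = 1) (col_sum : ∀ i, ∑ l, x l i = 1)
    (comul : ∀ i j, Coalgebra.comul (R := k) (x i j) = ∑ l, x i l ⊗ₜ[k] x l j)
    (counit : ∀ i j, Coalgebra.counit (R := k) (x i j) = if i = j then 1 else 0)
    (span : Submodule.span k (Set.range fun p : ι × ι => x p.1 p.2) = ⊤)
    {n : ℕ} (hn : Fintype.card ι = n) :
    IsQuotientOfQuantumSymmetric k H n := by
  let E : Fin n ≃ ι := (Fintype.equivFinOfCardEq hn).symm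
  have hx : IsMagic fun i j => x (E i) (E j) :=
    { row := fun i j l => by simp [row]
      col := fun i j l => by simp [col]
      row_sum := fun i => (E.sum_comp fun l => x (E i) l).trans (row_sum _)
      col_sum := fun i => (E.sum_comp fun l => x l (E i)).trans (col_sum _) }
  let f : QuantumSymmetric k n →ₐ[k] H := QuantumSymmetric.lift _ hx
  have hf : ∀ i j, f (QuantumSymmetric.u k n i j) = x (E i) (E j) :=
    QuantumSymmetric.lift_u _ hx
  refine ⟨BialgHom.ofAlgHom f ?_ ?_, ?_⟩
  · refine QuantumSymmetric.algHom_ext fun i j => ?_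
    simp [hf, counit, QuantumSymmetric.counit_u]
  · refine QuantumSymmetric.algHom_ext fun i j => ?_
    simp only [AlgHom.comp_apply, Bialgebra.comulAlgHom_apply, QuantumSymmetric.comul_u, map_sum,
      Algebra.TensorProduct.map_tmul, hf, comul]
    exact E.sum_comp fun l => x (E i) l ⊗ₜ[k] x l (E j)
  -- The entries span `H` linearly, so the range of `f` as a linear map is already everything and no
  -- products of generators are needed.
  · change Function.Surjective f
    refine LinearMap.range_eq_top (f := f.toLinearMap).1 (top_unique ?_)
    rw [← span, Submodule.span_le]
    rintro _ ⟨p, rfl⟩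
    exact ⟨QuantumSymmetric.u k n (E.symm p.1) (E.symm p.2), by simp [hf]⟩

end Quotient

/-! ### Homomorphisms from `ℤ/|G|` to `G` -/

section Powers

variable {G : Type*} [Group G] [Fintype G]

/-- Powers in a finite group with exponents modulo the order of the group. -/
def zmodPow (g : G) (i : ZMod (Fintype.card G)) : G := g ^ i.val

theorem zmodPow_zero (g : G) : zmodPow g 0 = 1 := by simp [zmodPow]

/-- For trivial `G` the representative of `1` is `0`, hence the detour through `1 % |G|`. -/
theorem zmodPow_one (g : G) : zmodPow g 1 = g := by
  rw [zmodPow, ZMod.val_one_eq_one_mod, pow_mod_card, pow_one]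

/-- By Lagrange, exponents matter only modulo `|G|`, whatever the order of `g`; one cyclic group
thus serves all elements. -/
theorem zmodPow_add (g : G) (i j : ZMod (Fintype.card G)) :
    zmodPow g (i + j) = zmodPow g i * zmodPow g j := by
  rw [zmodPow, ZMod.val_add, pow_mod_card, pow_add, zmodPow, zmodPow]

theorem conj_zmodPow (x g : G) (i : ZMod (Fintype.card G)) :
    x * zmodPow g i * x⁻¹ = zmodPow (x * g * x⁻¹) i := by
  rw [zmodPow, zmodPow, conj_pow]

end Powers

/-! ### The Hopf structure of `D(G)*` in the dual basis -/

namespace DrinfeldDouble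

variable {k G : Type*} [Field k] [Group G] [Fintype G] [DecidableEq G]

theorem dual_ext_e {φ ψ : HopfDual k (DrinfeldDouble k G)}
    (H : ∀ a b, HopfDual.toDual k _ φ (e k a b) = HopfDual.toDual k _ ψ (e k a b)) : φ = ψ :=
  (HopfDual.toDual k _).injective (hom_ext H)

theorem dual_tensor_ext_e
    {x y : HopfDual k (DrinfeldDouble k G) ⊗[k] HopfDual k (DrinfeldDouble k G)}
    (H : ∀ a b a' b', HopfDual.tensorEquiv k _ x (e k a b ⊗ₜ e k a' b') =
      HopfDual.tensorEquiv k _ y (e k a b ⊗ₜ e k a' b')) : x = y :=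
  (HopfDual.tensorEquiv k _).injective <| TensorProduct.ext <|
    hom_ext fun a b => hom_ext fun a' b' => H a b a' b'

/-- The basis of `D(G)*` dual to the basis `e_g ⋈ h`. -/
noncomputable def dualE (k : Type*) [Field k] (g h : G) : HopfDual k (DrinfeldDouble k G) :=
  (HopfDual.toDual k _).symm (ofBasis fun a b => if a = g ∧ b = h then 1 else 0)

theorem toDual_dualE (g h a b : G) :
    HopfDual.toDual k _ (dualE k g h) (e k a b) = if a = g ∧ b = h then 1 else 0 := by
  simp [dualE]

/-- The reversed product `g' * g` reflects the co-opposite: the first leg of `Δ(e_{uv} ⋈ h)` carries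
`v`, the second `u`. It is harmless for powers of a single element. -/
theorem dualE_mul_dualE (g h g' h' : G) :
    dualE k g h * dualE k g' h' = if h = h' then dualE k (g' * g) h else 0 := by
  refine dual_ext_e fun a b => ?_
  have key : ∀ u : G, (u⁻¹ * a = g ∧ u = g') ↔ (u = g' ∧ a = g' * g) := fun u => by
    constructor
    · rintro ⟨rfl, rfl⟩; simp
    · rintro ⟨rfl, rfl⟩; simp
  rw [HopfDual.mul_apply', comul_e]
  simp only [map_sum, TensorProduct.map_tmul, LinearMap.mul'_apply, toDual_dualE]
  rw [Finset.sum_eq_single g']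
  · by_cases hh : h = h'
    · subst hh
      simp only [if_true, toDual_dualE, inv_mul_eq_iff_eq_mul]
      split_ifs <;> simp_all
    · rw [if_neg hh, map_zero, LinearMap.zero_apply]
      split_ifs <;> simp_all
  · intro u _ hu
    simp [hu]
  · exact fun H => absurd (Finset.mem_univ _) H

theorem sum_dualE_one : ∑ h : G, dualE k 1 h = 1 := by
  refine dual_ext_e fun a b => ?_
  rw [HopfDual.one_apply, counit_e, map_sum, LinearMap.sum_apply]
  simp only [toDual_dualE]
  by_cases ha : a = 1 <;> simp [ha]

/-- The factorisations of `e_g ⋈ h` into two basis elements are `(e_g ⋈ b)(e_{b⁻¹gb} ⋈ b⁻¹h)`, one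
for each `b`. -/
theorem comul_dualE (g h : G) : Coalgebra.comul (R := k) (dualE k g h) =
    ∑ b : G, dualE k g b ⊗ₜ[k] dualE k (b⁻¹ * g * b) (b⁻¹ * h) := by
  refine dual_tensor_ext_e fun a b a' b' => ?_
  rw [HopfDual.tensorEquiv_comul, e_mul_e, map_sum, LinearMap.sum_apply]
  simp only [HopfDual.tensorEquiv_tmul, toDual_dualE]
  rw [Finset.sum_eq_single b]
  · have key : a = b * a' * b⁻¹ ↔ a' = b⁻¹ * a * b := by
      constructor <;> rintro rfl <;> group
    have key' : b * b' = h ↔ b' = b⁻¹ * h := eq_inv_mul_iff_mul_eq.symm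
    rw [apply_ite (HopfDual.toDual k _ (dualE k g h)), map_zero, toDual_dualE]
    simp only [key, key']
    by_cases ha : a = g
    · subst ha
      by_cases ha' : a' = b⁻¹ * a * b <;> by_cases hb' : b' = b⁻¹ * h <;> simp [ha', hb']
    · simp [ha]
  · intro u _ hu
    simp [Ne.symm hu]
  · exact fun H => absurd (Finset.mem_univ _) H

theorem counit_dualE (g h : G) :
    Coalgebra.counit (R := k) (dualE k g h) = if h = 1 then 1 else 0 := by
  rw [HopfDual.counit_apply, one_def, map_sum]
  simp only [toDual_dualE]
  by_cases hh : h = 1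
  · simp [hh]
  · simp [hh, Ne.symm hh]

theorem span_dualE :
    Submodule.span k (Set.range fun p : G × G => dualE k p.1 p.2) = ⊤ := by
  refine top_unique fun φ _ => ?_
  have : φ = ∑ p : G × G, HopfDual.toDual k _ φ (e k p.1 p.2) • dualE k p.1 p.2 := by
    refine dual_ext_e fun a b => ?_
    rw [map_sum, LinearMap.sum_apply, Finset.sum_eq_single (a, b)]
    · simp [toDual_dualE]
    · rintro ⟨g, h⟩ _ hgh
      have : ¬ (a = g ∧ b = h) := by rintro ⟨rfl, rfl⟩; exact hgh rfl
      simp [toDual_dualE, this]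
    · exact fun H => absurd (Finset.mem_univ _) H
  rw [this]
  exact Submodule.sum_mem _ fun p _ => Submodule.smul_mem _ _ (Submodule.subset_span ⟨p, rfl⟩)

/-! ### Fourier idempotents and the magic comatrix -/

section Fourier

variable (ψ : AddChar (ZMod (Fintype.card G)) k)

/-- The idempotents of the group algebra of the cyclic group generated by `c`, in the component
`h` of `D(G)*`. -/
noncomputable def fourier (c h : G) (t : ZMod (Fintype.card G)) :
    HopfDual k (DrinfeldDouble k G) :=
  (Fintype.card G : k)⁻¹ • ∑ i, ψ (i * t) • dualE k (zmodPow c i) h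

/-- The coefficients of the action of `D(G)` on the module algebra `∏_{g, x} k[ℤ/|G|]`, where the
factor at `(g, x)` is graded by `i ↦ x gⁱ x⁻¹` and `G` permutes the `x` by left translation, with
respect to the basis of minimal idempotents. -/
noncomputable def comatrix (p q : G × G × ZMod (Fintype.card G)) :
    HopfDual k (DrinfeldDouble k G) :=
  if p.1 = q.1 then fourier ψ (p.2.1 * p.1 * p.2.1⁻¹) (p.2.1 * q.2.1⁻¹) (p.2.2 - q.2.2) else 0

variable {ψ}

-- Orthogonality of characters: by primitivity `i ↦ ψ (i * t)` is trivial only for `t = 0`.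
omit [DecidableEq G] in
theorem sum_apply_mul (hψ : ψ.IsPrimitive) (t : ZMod (Fintype.card G)) :
    ∑ i, ψ (i * t) = if t = 0 then (Fintype.card G : k) else 0 := by
  rw [AddChar.sum_mulShift t hψ, ZMod.card]
  split_ifs <;> simp

theorem fourier_mul_fourier_of_ne {c c' h h' : G} (hh : h ≠ h') (s t : ZMod (Fintype.card G)) :
    fourier ψ c h s * fourier ψ c' h' t = 0 := by
  have : (∑ i, ψ (i * s) • dualE k (zmodPow c i) h) * ∑ i, ψ (i * t) • dualE k (zmodPow c' i) h' =
      0 := by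
    simp [Finset.sum_mul_sum, dualE_mul_dualE, hh]
  rw [fourier, fourier, smul_mul_smul_comm, this]
  exact smul_zero (A := HopfDual k (DrinfeldDouble k G)) _

variable [CharZero k]

omit [DecidableEq G] in
theorem card_ne_zero : (Fintype.card G : k) ≠ 0 := Nat.cast_ne_zero.2 Fintype.card_ne_zero

/-- Substituting `m = j + i` in the double sum splits off the character sum of `ψ (j * (t - s))`,
whose value at `s = t` cancels one of the two factors `|G|⁻¹`. If `c` has order less than `|G|`,
some of these idempotents vanish, which does no harm. -/
theorem fourier_mul_fourier (hψ : ψ.IsPrimitive) (c h : G) (s t : ZMod (Fintype.card G)) :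
    fourier ψ c h s * fourier ψ c h t = if s = t then fourier ψ c h s else 0 := by
  have : (∑ i, ψ (i * s) • dualE k (zmodPow c i) h) * ∑ i, ψ (i * t) • dualE k (zmodPow c i) h =
      ∑ j, ψ (j * (t - s)) • ∑ i, ψ (i * s) • dualE k (zmodPow c i) h := by
    simp only [Finset.sum_mul_sum, Finset.smul_sum]
    rw [Finset.sum_comm]
    refine Finset.sum_congr rfl fun j _ =>
      Fintype.sum_equiv (Equiv.addLeft j) _ _ fun i => ?_
    rw [smul_mul_smul_comm, dualE_mul_dualE, if_pos rfl, Equiv.coe_addLeft, zmodPow_add,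
      smul_smul, ← AddChar.map_add_eq_mul, ← AddChar.map_add_eq_mul]
    congr 2
    ring
  rw [fourier, fourier, smul_mul_smul_comm, this, ← Finset.sum_smul, sum_apply_mul hψ]
  simp only [sub_eq_zero, eq_comm (a := t)]
  split_ifs
  · rw [smul_smul, mul_assoc, inv_mul_cancel₀ card_ne_zero, mul_one]
  · simp

/-- Fourier inversion. The case `j = 0` gives the partition of unity, `j = 1` the spanning property,
and general `j` the comultiplication. -/
theorem sum_smul_fourier (hψ : ψ.IsPrimitive) (c h : G) (j : ZMod (Fintype.card G)) :
    ∑ t, ψ (-(j * t)) • fourier ψ c h t = dualE k (zmodPow c j) h := by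
  have : ∀ t, ψ (-(j * t)) • fourier ψ c h t = (Fintype.card G : k)⁻¹ •
      ∑ i, ψ (t * (i - j)) • dualE k (zmodPow c i) h := fun t => by
    rw [fourier, smul_comm, Finset.smul_sum]
    congr 1
    refine Finset.sum_congr rfl fun i _ => ?_
    rw [smul_smul, ← AddChar.map_add_eq_mul]
    congr 2
    ring
  simp only [this]
  rw [← Finset.smul_sum, Finset.sum_comm]
  simp only [← Finset.sum_smul, sum_apply_mul hψ, sub_eq_zero, ite_smul, zero_smul,
    Finset.sum_ite_eq', Finset.mem_univ, if_true]
  rw [smul_smul, inv_mul_cancel₀ card_ne_zero, one_smul]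

theorem sum_fourier (hψ : ψ.IsPrimitive) (c h : G) :
    ∑ t, fourier ψ c h t = dualE k 1 h := by
  simpa [zmodPow_zero] using sum_smul_fourier hψ c h 0

theorem counit_fourier (hψ : ψ.IsPrimitive) (c h : G) (t : ZMod (Fintype.card G)) :
    Coalgebra.counit (R := k) (fourier ψ c h t) = if h = 1 ∧ t = 0 then 1 else 0 := by
  simp only [fourier, map_smul, map_sum, counit_dualE, smul_eq_mul, ← Finset.sum_mul,
    sum_apply_mul hψ]
  by_cases hh : h = 1 <;> by_cases ht : t = 0 <;>
    simp [hh, ht]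

/-- The comultiplication sends the power `c ^ i` to `c ^ i` in the first leg and `(b⁻¹ c b) ^ i` in
the second. Expanding the second leg by Fourier inversion contributes the phase `ψ (-(i * l))`,
which shifts the first leg from `t` to `t - l`. -/
theorem comul_fourier (hψ : ψ.IsPrimitive) (c h : G) (t : ZMod (Fintype.card G)) :
    Coalgebra.comul (R := k) (fourier ψ c h t) = ∑ b, ∑ l,
      fourier ψ c b (t - l) ⊗ₜ[k] fourier ψ (b⁻¹ * c * b) (b⁻¹ * h) l := by
  have key : ∀ b i, ∑ l, ψ (i * (t - l)) • fourier ψ (b⁻¹ * c * b) (b⁻¹ * h) l =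
      ψ (i * t) • dualE k (b⁻¹ * zmodPow c i * b) (b⁻¹ * h) := fun b i => by
    have hp := conj_zmodPow b⁻¹ c i
    rw [inv_inv] at hp
    rw [hp, ← sum_smul_fourier hψ, Finset.smul_sum]
    refine Finset.sum_congr rfl fun l _ => ?_
    rw [smul_smul, ← AddChar.map_add_eq_mul]
    congr 2
    ring
  have key' : ∀ b, ∑ l, fourier ψ c b (t - l) ⊗ₜ[k] fourier ψ (b⁻¹ * c * b) (b⁻¹ * h) l =
      (Fintype.card G : k)⁻¹ • ∑ i, ψ (i * t) •
        dualE k (zmodPow c i) b ⊗ₜ[k] dualE k (b⁻¹ * zmodPow c i * b) (b⁻¹ * h) := fun b => by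
    simp only [← TensorProduct.tmul_smul, ← key, TensorProduct.tmul_sum]
    rw [Finset.sum_comm, Finset.smul_sum]
    refine Finset.sum_congr rfl fun l _ => ?_
    conv_lhs => rw [fourier]
    simp only [← TensorProduct.smul_tmul', TensorProduct.sum_tmul, TensorProduct.tmul_smul]
  simp only [key']
  rw [fourier, ← Finset.smul_sum, Finset.sum_comm, map_smul, map_sum]
  simp only [map_smul, comul_dualE, Finset.smul_sum]

theorem comatrix_row (hψ : ψ.IsPrimitive) (p q r : G × G × ZMod (Fintype.card G)) :
    comatrix ψ p q * comatrix ψ p r = if q = r then comatrix ψ p q else 0 := by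
  obtain ⟨g, y, s⟩ := p
  obtain ⟨g₁, x₁, t₁⟩ := q
  obtain ⟨g₂, x₂, t₂⟩ := r
  by_cases h₁ : g = g₁
  · subst h₁
    by_cases h₂ : g = g₂
    · subst h₂
      by_cases hx : x₁ = x₂
      · subst hx
        simp [comatrix, fourier_mul_fourier hψ]
      · simp [comatrix, fourier_mul_fourier_of_ne, hx]
    · simp [comatrix, h₂]
  · simp [comatrix, h₁]

/-- Along a row `c` is constant; along a column it varies with the row index. Yet two entries of a
column in the same component `h` have the same conjugating element, and if both are nonzero the same
`g`, so orthogonality for a fixed `c` suffices. -/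
theorem comatrix_col (hψ : ψ.IsPrimitive) (p q r : G × G × ZMod (Fintype.card G)) :
    comatrix ψ p q * comatrix ψ r q = if p = r then comatrix ψ p q else 0 := by
  obtain ⟨g, y, s⟩ := q
  obtain ⟨g₁, x₁, t₁⟩ := p
  obtain ⟨g₂, x₂, t₂⟩ := r
  by_cases h₁ : g₁ = g
  · subst h₁
    by_cases h₂ : g₂ = g₁
    · subst h₂
      by_cases hx : x₁ = x₂
      · subst hx
        simp [comatrix, fourier_mul_fourier hψ]
      · simp [comatrix, fourier_mul_fourier_of_ne, hx]
    · simp [comatrix, h₂, Ne.symm h₂]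
  · simp [comatrix, h₁]

theorem sum_comatrix_row (hψ : ψ.IsPrimitive) (p : G × G × ZMod (Fintype.card G)) :
    ∑ q, comatrix ψ p q = 1 := by
  obtain ⟨g, y, s⟩ := p
  simp only [comatrix, Fintype.sum_prod_type, Finset.sum_ite_irrel, Finset.sum_const_zero,
    Finset.sum_ite_eq, Finset.mem_univ, if_true]
  rw [← sum_dualE_one]
  -- As `x` varies, `y * x⁻¹` meets every component exactly once.
  refine Fintype.sum_equiv ((Equiv.inv G).trans (Equiv.mulLeft y)) _ _ fun x => ?_
  rw [← sum_fourier hψ (y * g * y⁻¹)]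
  exact Fintype.sum_equiv (Equiv.subLeft s) _ _ fun t => rfl

theorem sum_comatrix_col (hψ : ψ.IsPrimitive) (q : G × G × ZMod (Fintype.card G)) :
    ∑ p, comatrix ψ p q = 1 := by
  obtain ⟨g, y, s⟩ := q
  simp only [comatrix, Fintype.sum_prod_type, Finset.sum_ite_irrel, Finset.sum_const_zero,
    Finset.sum_ite_eq', Finset.mem_univ, if_true]
  rw [← sum_dualE_one]
  refine Fintype.sum_equiv (Equiv.mulRight y⁻¹) _ _ fun x => ?_
  -- Here `c` changes with the component, but the idempotents add up to the same unit for every `c`.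
  rw [Equiv.coe_mulRight, ← sum_fourier hψ (x * g * x⁻¹)]
  exact Fintype.sum_equiv (Equiv.subRight s) _ _ fun t => rfl

theorem counit_comatrix (hψ : ψ.IsPrimitive) (p q : G × G × ZMod (Fintype.card G)) :
    Coalgebra.counit (R := k) (comatrix ψ p q) = if p = q then 1 else 0 := by
  obtain ⟨g, y, s⟩ := p
  obtain ⟨g', x, t⟩ := q
  by_cases h : g = g'
  · simp [comatrix, h, counit_fourier hψ, mul_inv_eq_one, sub_eq_zero]
  · simp [comatrix, h]

theorem comul_comatrix (hψ : ψ.IsPrimitive) (p q : G × G × ZMod (Fintype.card G)) :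
    Coalgebra.comul (R := k) (comatrix ψ p q) =
      ∑ r, comatrix ψ p r ⊗ₜ[k] comatrix ψ r q := by
  obtain ⟨g, y, s⟩ := p
  obtain ⟨g', x, t⟩ := q
  rw [Fintype.sum_prod_type, Finset.sum_eq_single g]
  · by_cases h : g = g'
    · subst h
      simp only [comatrix, if_true, comul_fourier hψ, Fintype.sum_prod_type]
      -- With `b = y z⁻¹`, the conjugate of `y g y⁻¹` is `z g z⁻¹` and `b⁻¹ (y x⁻¹) = z x⁻¹`, as the
      -- entry in row `z` demands; the shift by `t` then matches the Fourier indices.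
      refine (Fintype.sum_equiv ((Equiv.inv G).trans (Equiv.mulLeft y)) _ _ fun z => ?_).symm
      refine Fintype.sum_equiv (Equiv.subRight t) _ _ fun l => ?_
      simp [mul_assoc]
    · simp [comatrix, h]
  · intro g₁ _ h
    simp [comatrix, Ne.symm h]
  · exact fun H => absurd (Finset.mem_univ _) H

theorem span_comatrix (hψ : ψ.IsPrimitive) :
    Submodule.span k (Set.range fun p : (G × G × ZMod (Fintype.card G)) ×
      (G × G × ZMod (Fintype.card G)) => comatrix ψ p.1 p.2) = ⊤ := by
  rw [← top_le_iff, ← span_dualE, Submodule.span_le]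
  rintro _ ⟨⟨g, h⟩, rfl⟩
  have := sum_smul_fourier hψ g h 1
  rw [zmodPow_one] at this
  simp only [← this]
  refine Submodule.sum_mem _ fun t _ => Submodule.smul_mem _ _ (Submodule.subset_span ?_)
  -- Choosing `y = 1` and `x = h⁻¹` makes `c = g` and the component `h`, so every `fourier ψ g h t`
  -- is itself an entry.
  exact ⟨((g, 1, t), (g, h⁻¹, 0)), by simp [comatrix]⟩

end Fourier

/-! ### The degree bound -/

theorem isQuotientOfQuantumSymmetric_dual (k G : Type*) [Field k] [IsAlgClosed k] [CharZero k]
    [Group G] [Fintype G] [DecidableEq G] :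
    IsQuotientOfQuantumSymmetric k (HopfDual k (DrinfeldDouble k G)) (Fintype.card G ^ 3) := by
  -- Invertibility of `|G|` in the algebraically closed field `k` is what provides a primitive root
  -- of unity of order `|G|`, hence a primitive character of `ℤ/|G|`.
  have : NeZero (Fintype.card G : k) := ⟨card_ne_zero⟩
  obtain ⟨ζ, hζ⟩ := HasEnoughRootsOfUnity.exists_primitiveRoot k (Fintype.card G)
  have hψ := AddChar.zmodChar_primitive_of_primitive_root _ hζ
  refine .of_comatrix (comatrix _) (comatrix_row hψ) (fun i j l => comatrix_col hψ i j l)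
    (sum_comatrix_row hψ) (sum_comatrix_col hψ) (comul_comatrix hψ) (counit_comatrix hψ)
    (span_comatrix hψ) ?_
  simp only [Fintype.card_prod, ZMod.card]
  ring

end DrinfeldDouble

theorem corollary5p3 (k : Type*) [Field k] [IsAlgClosed k] [CharZero k]
    (G : Type*) [Group G] [Fintype G] [DecidableEq G] :
    IsQuantumPermutationAlgebra k (HopfDual k (DrinfeldDouble k G)) ∧
      quantumPermutationDegree k (HopfDual k (DrinfeldDouble k G)) ≤ Fintype.card G ^ 3 :=
  have h : 1 ≤ Fintype.card G ^ 3 ∧ IsQuotientOfQuantumSymmetric k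
      (HopfDual k (DrinfeldDouble k G)) (Fintype.card G ^ 3) :=
    ⟨Nat.one_le_pow _ _ Fintype.card_pos, DrinfeldDouble.isQuotientOfQuantumSymmetric_dual k G⟩
  ⟨⟨_, h⟩, Nat.sInf_le h⟩
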